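/- Let $(M,g)$ be a connected smooth Riemannian manifold of dimension $n\ge 3$, and let $R_{abcd}$ be its covariant Riemann curvature tensor, with the convention $\nabla_a\nabla_bA_c-\nabla_b\nabla_aA_c=R_{abc}{}^{d}A_d$ for 1-forms $A$, where $\nabla$ is the Levi-Civita connection. For $x\in M$ and a 2-form $L=L_{ab}\in\Lambda^2T_x^*M$ put \[ (R\star L)_{abcd} := R_{sbcd}\,L^{s}{}_{a}+R_{ascd}\,L^{s}{}_{b}+R_{absd}\,L^{s}{}_{c}+R_{abcs}\,L^{s}{}_{d}, \] where indices are raised by $g$ and repeated indices are summed. Then $M$ is a space of constant curvature (that is, there is a constant $\kappa\in\mathbb{R}$ such that every tangent 2-plane at every point of $M$ has sectional curvature $\kappa$) if and only if \[ R\star L=0\qquad\text{for every } x\in M \text{ and every } L\in\Lambda^2T_x^*M. \] -/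

import Mathlib

open Bundle VectorField
open scoped Manifold ContDiff

noncomputable section

namespace ConstCurv

section LeviCivita

variable {E : Type*} [NormedAddCommGroup E] [NormedSpace ℝ E] [FiniteDimensional ℝ E]
  {H : Type*} [TopologicalSpace H] {I : ModelWithCorners ℝ E H}
  {M : Type*} [TopologicalSpace M] [ChartedSpace H M] [IsManifold I ∞ M]

variable (I M) in
/-- Smooth Riemannian metrics on the manifold `M`. -/
abbrev Metric := ContMDiffRiemannianMetric I ∞ E (fun x : M ↦ TangentSpace I x)

variable (g : Metric I M)

/-- The inner product `g_x` on `T_x M` as a bilinear form. -/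
def form (x : M) : LinearMap.BilinForm ℝ (TangentSpace I x) :=
  LinearMap.mk₂ ℝ (fun v w ↦ g.inner x v w) (by simp) (by simp) (by simp) (by simp)

theorem form_nondegenerate (x : M) : (form g x).Nondegenerate := by
  constructor
  · intro v hv
    by_contra h
    exact (g.pos x v h).ne' (hv v)
  · intro v hv
    by_contra h
    exact (g.pos x v h).ne' (hv v)

theorem mdifferentiableAt_inner {x : M} {Y Z : Π x : M, TangentSpace I x}
    (hY : MDiffAt (T% Y) x) (hZ : MDiffAt (T% Z) x) :
    MDiffAt (fun y ↦ g.inner y (Y y) (Z y)) x := by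
  have : MDifferentiableAt I (I.prod 𝓘(ℝ)) (fun m ↦
      TotalSpace.mk' ℝ (E := Bundle.Trivial M ℝ) m (g.inner m (Y m) (Z m))) x := by
    apply MDifferentiableAt.clm_bundle_apply₂ (F₁ := E) (F₂ := E)
    · exact g.contMDiff.mdifferentiableAt (by simp)
    · exact hY
    · exact hZ
  simp only [mdifferentiableAt_totalSpace] at this
  exact this.2

/-- The Koszul expression: half of
`X⟨Y,Z⟩ + Y⟨Z,X⟩ - Z⟨X,Y⟩ + ⟨[X,Y],Z⟩ - ⟨[Y,Z],X⟩ + ⟨[Z,X],Y⟩` at the point `x`. -/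
def koszul (X Y Z : Π x : M, TangentSpace I x) (x : M) : ℝ :=
  (1 / 2 : ℝ) *
    (d% (fun y ↦ g.inner y (Y y) (Z y)) x (X x)
      + d% (fun y ↦ g.inner y (Z y) (X y)) x (Y x)
      - d% (fun y ↦ g.inner y (X y) (Y y)) x (Z x)
      + g.inner x (mlieBracket I X Y x) (Z x)
      - g.inner x (mlieBracket I Y Z x) (X x)
      + g.inner x (mlieBracket I Z X x) (Y x))

theorem mvfderiv_inner_smul_left {x : M} {f : M → ℝ} {Y Z : Π x : M, TangentSpace I x}
    (hf : MDiffAt f x) (hY : MDiffAt (T% Y) x) (hZ : MDiffAt (T% Z) x) :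
    d% (fun y ↦ g.inner y ((f • Y) y) (Z y)) x
      = f x • d% (fun y ↦ g.inner y (Y y) (Z y)) x + g.inner x (Y x) (Z x) • d% f x := by
  have : (fun y ↦ g.inner y ((f • Y) y) (Z y)) = fun y ↦ f y * g.inner y (Y y) (Z y) := by
    ext y; simp
  rw [this, mvfderiv_fun_mul hf (mdifferentiableAt_inner g hY hZ)]

theorem mvfderiv_inner_smul_right {x : M} {f : M → ℝ} {Y Z : Π x : M, TangentSpace I x}
    (hf : MDiffAt f x) (hY : MDiffAt (T% Y) x) (hZ : MDiffAt (T% Z) x) :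
    d% (fun y ↦ g.inner y (Y y) ((f • Z) y)) x
      = f x • d% (fun y ↦ g.inner y (Y y) (Z y)) x + g.inner x (Y x) (Z x) • d% f x := by
  have : (fun y ↦ g.inner y (Y y) ((f • Z) y)) = fun y ↦ f y * g.inner y (Y y) (Z y) := by
    ext y; simp
  rw [this, mvfderiv_fun_mul hf (mdifferentiableAt_inner g hY hZ)]

theorem mvfderiv_inner_add_left {x : M} {Y Y' Z : Π x : M, TangentSpace I x}
    (hY : MDiffAt (T% Y) x) (hY' : MDiffAt (T% Y') x) (hZ : MDiffAt (T% Z) x) :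
    d% (fun y ↦ g.inner y ((Y + Y') y) (Z y)) x
      = d% (fun y ↦ g.inner y (Y y) (Z y)) x + d% (fun y ↦ g.inner y (Y' y) (Z y)) x := by
  have : (fun y ↦ g.inner y ((Y + Y') y) (Z y))
      = fun y ↦ g.inner y (Y y) (Z y) + g.inner y (Y' y) (Z y) := by
    ext y; simp
  rw [this, mvfderiv_fun_add (mdifferentiableAt_inner g hY hZ) (mdifferentiableAt_inner g hY' hZ)]

theorem mvfderiv_inner_add_right {x : M} {Y Z Z' : Π x : M, TangentSpace I x}
    (hY : MDiffAt (T% Y) x) (hZ : MDiffAt (T% Z) x) (hZ' : MDiffAt (T% Z') x) :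
    d% (fun y ↦ g.inner y (Y y) ((Z + Z') y)) x
      = d% (fun y ↦ g.inner y (Y y) (Z y)) x + d% (fun y ↦ g.inner y (Y y) (Z' y)) x := by
  have : (fun y ↦ g.inner y (Y y) ((Z + Z') y))
      = fun y ↦ g.inner y (Y y) (Z y) + g.inner y (Y y) (Z' y) := by
    ext y; simp
  rw [this, mvfderiv_fun_add (mdifferentiableAt_inner g hY hZ) (mdifferentiableAt_inner g hY hZ')]

theorem koszul_tensorial_right {x : M} (X Y : Π x : M, TangentSpace I x)
    (hX : MDiffAt (T% X) x) (hY : MDiffAt (T% Y) x) :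
    TensorialAt I E (fun Z ↦ koszul g X Y Z x) x where
  smul {f Z} hf hZ := by
    simp only [koszul]
    rw [mvfderiv_inner_smul_right g hf hY hZ, mvfderiv_inner_smul_left g hf hZ hX,
      mlieBracket_smul_left hf hZ, mlieBracket_smul_right hf hZ]
    simp
    rw [g.symm x (Z x) (X x), g.symm x (Z x) (Y x)]
    ring
  add {Z Z'} hZ hZ' := by
    simp only [koszul]
    rw [mvfderiv_inner_add_right g hY hZ hZ', mvfderiv_inner_add_left g hZ hZ' hX,
      mlieBracket_add_left hZ hZ', mlieBracket_add_right hZ hZ']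
    simp
    ring

theorem koszul_tensorial_left {x : M} (Y Z : Π x : M, TangentSpace I x)
    (hY : MDiffAt (T% Y) x) (hZ : MDiffAt (T% Z) x) :
    TensorialAt I E (fun X ↦ koszul g X Y Z x) x where
  smul {f X} hf hX := by
    simp only [koszul]
    rw [mvfderiv_inner_smul_right g hf hZ hX, mvfderiv_inner_smul_left g hf hX hY,
      mlieBracket_smul_left hf hX, mlieBracket_smul_right hf hX]
    simp
    rw [g.symm x (Z x) (X x)]
    ring
  add {X X'} hX hX' := by
    simp only [koszul]
    rw [mvfderiv_inner_add_right g hZ hX hX', mvfderiv_inner_add_left g hX hX' hY,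
      mlieBracket_add_left hX hX', mlieBracket_add_right hX hX']
    simp
    ring

theorem koszul_add {x : M} {X Y Y' Z : Π x : M, TangentSpace I x}
    (hX : MDiffAt (T% X) x) (hY : MDiffAt (T% Y) x) (hY' : MDiffAt (T% Y') x)
    (hZ : MDiffAt (T% Z) x) :
    koszul g X (Y + Y') Z x = koszul g X Y Z x + koszul g X Y' Z x := by
  simp only [koszul]
  rw [mvfderiv_inner_add_right g hX hY hY', mvfderiv_inner_add_left g hY hY' hZ,
    mlieBracket_add_left hY hY', mlieBracket_add_right hY hY']
  simp
  ring

theorem koszul_smul {x : M} {f : M → ℝ} {X Y Z : Π x : M, TangentSpace I x}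
    (hf : MDiffAt f x) (hX : MDiffAt (T% X) x) (hY : MDiffAt (T% Y) x)
    (hZ : MDiffAt (T% Z) x) :
    koszul g X (f • Y) Z x = f x * koszul g X Y Z x + d% f x (X x) * g.inner x (Y x) (Z x) := by
  simp only [koszul]
  rw [mvfderiv_inner_smul_right g hf hX hY, mvfderiv_inner_smul_left g hf hY hZ,
    mlieBracket_smul_left hf hY, mlieBracket_smul_right hf hY]
  simp
  rw [g.symm x (X x) (Y x)]
  ring

/-- For a vector field `Y` differentiable at `x`, the bilinear form
`(X, Z) ↦ ⟨∇_X Y, Z⟩` on `T_x M`, given by the Koszul formula. -/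
def koszulForm {x : M} {Y : Π x : M, TangentSpace I x} (hY : MDiffAt (T% Y) x) :
    TangentSpace I x →L[ℝ] TangentSpace I x →L[ℝ] ℝ :=
  TensorialAt.mkHom₂ (F := E) (F' := E) (fun X Z ↦ koszul g X Y Z x) x
    (fun Z hZ ↦ koszul_tensorial_left g Y Z hY hZ)
    (fun X hX ↦ koszul_tensorial_right g X Y hX hY)

theorem koszulForm_apply {x : M} {X Y Z : Π x : M, TangentSpace I x}
    (hX : MDiffAt (T% X) x) (hY : MDiffAt (T% Y) x) (hZ : MDiffAt (T% Z) x) :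
    koszulForm g hY (X x) (Z x) = koszul g X Y Z x :=
  TensorialAt.mkHom₂_apply (F := E) (F' := E) _ _ hX hZ

instance (x : M) : FiniteDimensional ℝ (TangentSpace I x) :=
  VectorBundle.finiteDimensional ℝ E (fun x : M ↦ TangentSpace I x) x

/-- The musical isomorphism `T_x^* M → T_x M`: the vector `v` with `g_x(v, ·) = φ`. -/
def sharp (x : M) : Module.Dual ℝ (TangentSpace I x) ≃ₗ[ℝ] TangentSpace I x :=
  ((form g x).toDual (form_nondegenerate g x)).symm

theorem inner_sharp (x : M) (φ : Module.Dual ℝ (TangentSpace I x)) (v : TangentSpace I x) :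
    g.inner x (sharp g x φ) v = φ v :=
  LinearMap.BilinForm.apply_toDual_symm_apply (B := form g x) φ v

theorem eq_of_inner_eq {x : M} {v w : TangentSpace I x}
    (h : ∀ z, g.inner x v z = g.inner x w z) : v = w := by
  rw [← sub_eq_zero]
  refine (form_nondegenerate g x).1 _ fun z ↦ ?_
  change g.inner x (v - w) z = 0
  simp [h z]

open scoped Classical in
/-- The Levi-Civita derivative `X₀ ↦ ∇_{X₀} Y` at `x`: the vector representing
`Z₀ ↦ ⟨∇_{X₀} Y, Z₀⟩`. (At points where `Y` is not differentiable the value is `0`.) -/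
def nabla (Y : Π x : M, TangentSpace I x) (x : M) :
    TangentSpace I x →L[ℝ] TangentSpace I x :=
  if hY : MDiffAt (T% Y) x then
    haveI : T2Space (TangentSpace I x) := FiberBundle.t2Space E (fun x : M ↦ TangentSpace I x) x
    LinearMap.toContinuousLinearMap
      { toFun := fun X₀ ↦ sharp g x (koszulForm g hY X₀).toLinearMap
        map_add' := by intro v w; rw [← map_add]; simp
        map_smul' := by intro c v; rw [← map_smul]; simp }
  else 0

theorem inner_nabla {x : M} {X Y Z : Π x : M, TangentSpace I x}
    (hX : MDiffAt (T% X) x) (hY : MDiffAt (T% Y) x) (hZ : MDiffAt (T% Z) x) :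
    g.inner x (nabla g Y x (X x)) (Z x) = koszul g X Y Z x := by
  rw [nabla, dif_pos hY, ← koszulForm_apply g hX hY hZ]
  exact inner_sharp g x _ _

theorem nabla_eq_of_koszul {x : M} {Y : Π x : M, TangentSpace I x} (hY : MDiffAt (T% Y) x)
    (A : TangentSpace I x →L[ℝ] TangentSpace I x)
    (hA : ∀ X Z : Π x : M, TangentSpace I x, MDiffAt (T% X) x → MDiffAt (T% Z) x →
      koszul g X Y Z x = g.inner x (A (X x)) (Z x)) :
    nabla g Y x = A := by
  ext v
  refine eq_of_inner_eq g fun z ↦ ?_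
  have hv := FiberBundle.mdifferentiableAt_extend I E v
  have hz := FiberBundle.mdifferentiableAt_extend I E z
  have h1 := inner_nabla g hv hY hz
  have h2 := hA _ _ hv hz
  simp only [FiberBundle.extend_apply_self] at h1 h2
  rw [h1, h2]

/-- The Levi-Civita connection of `g`. -/
def leviCivita : CovariantDerivative I E (fun x : M ↦ TangentSpace I x) where
  toFun := nabla g
  isCovariantDerivativeOnUniv :=
    { add := by
        intro Y Y' x hY hY' _
        refine nabla_eq_of_koszul g (mdifferentiableAt_add_section hY hY') _ fun X Z hX hZ ↦ ?_
        rw [koszul_add g hX hY hY' hZ, ← inner_nabla g hX hY hZ, ← inner_nabla g hX hY' hZ]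
        simp
      leibniz := by
        intro Y f x hY hf _
        refine nabla_eq_of_koszul g (hf.smul_section hY) _ fun X Z hX hZ ↦ ?_
        rw [koszul_smul g hf hX hY hZ, ← inner_nabla g hX hY hZ]
        simp }

/-- The Levi-Civita connection is compatible with the metric. -/
theorem leviCivita_metric {x : M} {X Y Z : Π x : M, TangentSpace I x}
    (hX : MDiffAt (T% X) x) (hY : MDiffAt (T% Y) x) (hZ : MDiffAt (T% Z) x) :
    d% (fun y ↦ g.inner y (Y y) (Z y)) x (X x)
      = g.inner x (leviCivita g Y x (X x)) (Z x) + g.inner x (Y x) (leviCivita g Z x (X x)) := by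
  rw [g.symm x (Y x)]
  change _ = g.inner x (nabla g Y x (X x)) (Z x) + g.inner x (nabla g Z x (X x)) (Y x)
  rw [inner_nabla g hX hY hZ, inner_nabla g hX hZ hY]
  simp only [koszul]
  have h1 : (fun y ↦ g.inner y (Z y) (Y y)) = fun y ↦ g.inner y (Y y) (Z y) :=
    funext fun y ↦ g.symm y _ _
  have h2 : (fun y ↦ g.inner y (X y) (Z y)) = fun y ↦ g.inner y (Z y) (X y) :=
    funext fun y ↦ g.symm y _ _
  have h3 : (fun y ↦ g.inner y (Y y) (X y)) = fun y ↦ g.inner y (X y) (Y y) :=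
    funext fun y ↦ g.symm y _ _
  rw [h1, h2, h3, mlieBracket_swap_apply (V := X) (W := Y),
    mlieBracket_swap_apply (V := Z) (W := Y), mlieBracket_swap_apply (V := X) (W := Z)]
  simp
  ring

/-- The Levi-Civita connection is torsion-free. -/
theorem leviCivita_torsion : (leviCivita g).torsion = 0 := by
  rw [CovariantDerivative.torsion_eq_zero_iff]
  intro X Y x hX hY
  refine eq_of_inner_eq g fun z ↦ ?_
  have hz := FiberBundle.mdifferentiableAt_extend I E z
  rw [← FiberBundle.extend_apply_self E z]
  generalize FiberBundle.extend E z = Z at hz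
  change g.inner x (nabla g Y x (X x) - nabla g X x (Y x)) (Z x) = _
  rw [map_sub, sub_apply, inner_nabla g hX hY hz, inner_nabla g hY hX hz]
  simp only [koszul]
  have h1 : (fun y ↦ g.inner y (Z y) (Y y)) = fun y ↦ g.inner y (Y y) (Z y) :=
    funext fun y ↦ g.symm y _ _
  have h2 : (fun y ↦ g.inner y (X y) (Z y)) = fun y ↦ g.inner y (Z y) (X y) :=
    funext fun y ↦ g.symm y _ _
  have h3 : (fun y ↦ g.inner y (Y y) (X y)) = fun y ↦ g.inner y (X y) (Y y) :=
    funext fun y ↦ g.symm y _ _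
  rw [h1, h2, h3, mlieBracket_swap_apply (V := Y) (W := X),
    mlieBracket_swap_apply (V := Z) (W := Y), mlieBracket_swap_apply (V := X) (W := Z)]
  simp
  ring

/-- The curvature operator `R(u,v)w = ∇_U ∇_V W - ∇_V ∇_U W - ∇_{[U,V]} W` at `x`, where
`U`, `V`, `W` extend `u`, `v`, `w` to vector fields that are smooth near `x`. -/
def curvatureOp (x : M) (u v w : TangentSpace I x) : TangentSpace I x :=
  let U : Π y : M, TangentSpace I y := FiberBundle.extend E u
  let V : Π y : M, TangentSpace I y := FiberBundle.extend E v
  let W : Π y : M, TangentSpace I y := FiberBundle.extend E w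
  leviCivita g (fun y ↦ leviCivita g W y (V y)) x (U x)
    - leviCivita g (fun y ↦ leviCivita g W y (U y)) x (V x)
    - leviCivita g W x (mlieBracket I U V x)

/-- The covariant Riemann tensor `R_{abcd}`, in the convention
`∇_a ∇_b A_c - ∇_b ∇_a A_c = R_{abc}{}^d A_d` for 1-forms `A`, that is,
`R(a,b,c,d) = ⟨R(a,b)d, c⟩`. -/
def riemann (x : M) (a b c d : TangentSpace I x) : ℝ :=
  g.inner x (curvatureOp g x a b d) c

/-- The sectional curvature of the plane spanned by `u` and `v`. -/
def sectionalCurvature (x : M) (u v : TangentSpace I x) : ℝ :=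
  riemann g x u v u v / (g.inner x u u * g.inner x v v - g.inner x u v ^ 2)

/-- `M` is a space of constant curvature: all tangent planes at all points have the same
sectional curvature. -/
def HasConstantCurvature : Prop :=
  ∃ κ : ℝ, ∀ (x : M) (u v : TangentSpace I x),
    LinearIndependent ℝ ![u, v] → sectionalCurvature g x u v = κ

/-- Raising the first index of a bilinear form: the endomorphism `a ↦ L^s{}_a`, determined by
`g(L^s{}_a, t) = L(t, a)`. -/
def raise (x : M) (L : LinearMap.BilinForm ℝ (TangentSpace I x)) (a : TangentSpace I x) :
    TangentSpace I x :=
  sharp g x (L.flip a)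

/-- The derivation `B ⋆ L` for a covariant 4-tensor `B` and a covariant 2-tensor `L` on `T_x M`:
`(B ⋆ L)_{abcd} = B_{sbcd} L^s_a + B_{ascd} L^s_b + B_{absd} L^s_c + B_{abcs} L^s_d`. -/
def star (x : M)
    (B : TangentSpace I x → TangentSpace I x → TangentSpace I x → TangentSpace I x → ℝ)
    (L : LinearMap.BilinForm ℝ (TangentSpace I x)) (a b c d : TangentSpace I x) : ℝ :=
  B (raise g x L a) b c d + B a (raise g x L b) c d
    + B a b (raise g x L c) d + B a b c (raise g x L d)

end LeviCivita

end ConstCurv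

end

/-!
On the one hand, if all sectional curvatures equal `κ`, then polarization (an algebraic curvature
tensor is determined by its sectional curvatures, `IsAlgCurv.eq_of_sectional`) gives
`R_{abcd} = κ (g_{ac} g_{bd} - g_{ad} g_{bc})`. For a 2-form `L` the endomorphism `L^s_a` is
skew-adjoint, so as a derivation it annihilates `g`, and with it `R`.

On the other hand, the equation `R ⋆ L = 0` for the 2-forms generating the infinitesimal rotations
`v ↦ g(v,q) p - g(v,p) q` can be contracted: setting `a = q` and summing over an orthonormal basis
yields `(n - 1) R_{pbcd} = g_{cp} Ric_{bd} - g_{dp} Ric_{bc}`, where `Ric` is the Ricci contraction,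
and a second contraction shows that `Ric` is a multiple of `g` (`IsAlgCurv.exists_const`). Hence at
each point `x` the curvature is constant, with a value `K x`. That `K` does not depend on `x` is
Schur's lemma (`schur`): `K` is smooth, being a sectional curvature of local vector fields, the
second Bianchi identity `curv_bianchi₂` forces its differential to vanish in dimension at least `3`
(`dir_relation_of_const`), and `M` is connected.

These arguments use the classical properties of the Levi-Civita connection and its curvature.
The connection preserves smoothness of vector fields because its inner products with smooth fields
are given by the Koszul formula (`SmoothField.of_inner`). The identity `[U,V]f = U(Vf) - V(Uf)`
(`dir_bracket`) gives both the tensoriality of `R(U,V)W` in `W` and its skew-adjointness. By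
tensoriality (`curvatureOp_eq`) the curvature at a point may be computed from arbitrary smooth
extensions, so that the Bianchi identities become the Jacobi identity for the Lie bracket.
-/

namespace ConstCurv

open Filter Topology Module

/-! ### Vector fields smooth near a point -/

section Smooth

variable {E : Type*} [NormedAddCommGroup E] [NormedSpace ℝ E]
  {H : Type*} [TopologicalSpace H] {I : ModelWithCorners ℝ E H}
  {M : Type*} [TopologicalSpace M] [ChartedSpace H M]

variable (I) in
/-- The function `f` is smooth on a neighbourhood of `x`. (Mathlib's `ContMDiffAt` with exponent `∞`
is weaker: it allows a neighbourhood depending on the order of differentiation.) -/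
def SmoothFun (f : M → ℝ) (x : M) : Prop := ∀ᶠ y in 𝓝 x, CMDiffAt ∞ f y

variable {x : M} {f f' : M → ℝ}

theorem SmoothFun.mdiff (h : SmoothFun I f x) : MDiffAt f x :=
  h.self_of_nhds.mdifferentiableAt (by simp)

theorem SmoothFun.eventually (h : SmoothFun I f x) : ∀ᶠ y in 𝓝 x, SmoothFun I f y :=
  eventually_eventually_nhds.2 h

theorem SmoothFun.congr (h : SmoothFun I f x) (hf : f' =ᶠ[𝓝 x] f) : SmoothFun I f' x := by
  filter_upwards [h, hf.eventuallyEq_nhds] with y hy hfy using hy.congr_of_eventuallyEq hfy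

theorem SmoothFun.const (c : ℝ) : SmoothFun I (fun _ : M ↦ c) x :=
  Eventually.of_forall fun _ ↦ contMDiffAt_const

theorem SmoothFun.add (h : SmoothFun I f x) (h' : SmoothFun I f' x) :
    SmoothFun I (fun y ↦ f y + f' y) x := by
  filter_upwards [h, h'] with y hy hy' using hy.add hy'

theorem SmoothFun.sub (h : SmoothFun I f x) (h' : SmoothFun I f' x) :
    SmoothFun I (fun y ↦ f y - f' y) x := by
  filter_upwards [h, h'] with y hy hy' using hy.sub hy'

theorem SmoothFun.mul (h : SmoothFun I f x) (h' : SmoothFun I f' x) :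
    SmoothFun I (fun y ↦ f y * f' y) x := by
  filter_upwards [h, h'] with y hy hy' using hy.mul hy'

variable [IsManifold I ∞ M]

/-- The vector field `X` is smooth on a neighbourhood of `x`. -/
def SmoothField (X : Π x : M, TangentSpace I x) (x : M) : Prop :=
  ∀ᶠ y in 𝓝 x, CMDiffAt ∞ (T% X) y

variable {X Y Z : Π x : M, TangentSpace I x}

theorem SmoothField.mdiff (h : SmoothField X x) : MDiffAt (T% X) x :=
  h.self_of_nhds.mdifferentiableAt (by simp)

theorem SmoothField.eventually (h : SmoothField X x) : ∀ᶠ y in 𝓝 x, SmoothField X y :=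
  eventually_eventually_nhds.2 h

theorem SmoothField.congr (h : SmoothField X x) (hX : ∀ᶠ y in 𝓝 x, Y y = X y) :
    SmoothField Y x := by
  filter_upwards [h, eventually_eventually_nhds.2 hX] with y hy hfy
  exact hy.congr_of_eventuallyEq (hfy.mono fun z hz ↦ by simp [hz])

theorem SmoothField.add (h : SmoothField X x) (h' : SmoothField Y x) : SmoothField (X + Y) x := by
  filter_upwards [h, h'] with y hy hy' using hy.add_section hy'

theorem SmoothField.sub (h : SmoothField X x) (h' : SmoothField Y x) : SmoothField (X - Y) x := by
  filter_upwards [h, h'] with y hy hy' using hy.sub_section hy'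

theorem SmoothField.smul (h : SmoothFun I f x) (h' : SmoothField Y x) :
    SmoothField (f • Y) x := by
  filter_upwards [h, h'] with y hy hy' using hy.smul_section hy'

theorem SmoothField.sum {ι : Type*} {s : Finset ι} {X : ι → Π x : M, TangentSpace I x}
    (h : ∀ i ∈ s, SmoothField (X i) x) : SmoothField (fun y ↦ ∑ i ∈ s, X i y) x := by
  have h' : ∀ᶠ y in 𝓝 x, ∀ i ∈ s, CMDiffAt ∞ (T% (X i)) y := (eventually_all_finset s).2 h
  filter_upwards [h'] with y hy
  exact ContMDiffAt.sum_section hy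

theorem SmoothField.bracket [CompleteSpace E] (hX : SmoothField X x) (hY : SmoothField Y x) :
    SmoothField (mlieBracket I X Y) x := by
  have : IsManifold I (((⊤ : ℕ∞) : ℕ∞ω) + 1) M := by
    simpa using (inferInstance : IsManifold I ∞ M)
  have : IsManifold I (minSmoothness ℝ 2) M := by
    simpa using (inferInstance : IsManifold I 2 M)
  filter_upwards [hX, hY] with y hy hy'
  exact ContMDiffAt.mlieBracket_vectorField (n := ⊤) (m := ⊤) hy hy' (by simp)

/-- The derivative `X f` is the second component of the tangent map of `f`, evaluated along `X`. -/
theorem SmoothFun.dir (hf : SmoothFun I f x) (hX : SmoothField X x) :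
    SmoothFun I (fun y ↦ d% f y (X y)) x := by
  obtain ⟨u, hu, huo, hxu⟩ := eventually_nhds_iff.1 (hf.and hX)
  refine eventually_nhds_iff.2 ⟨u, fun y hy ↦ ?_, huo, hxu⟩
  have hf' : CMDiff[u] ∞ f := fun z hz ↦ (hu z hz).1.contMDiffWithinAt
  have h1 := hf'.contMDiffOn_tangentMapWithin (m := ∞) (by simp) huo.uniqueMDiffOn
  have h2 : CMDiff[u] ∞ (T% X) := fun z hz ↦ (hu z hz).2.contMDiffWithinAt
  have h3 := h1.comp h2 (fun z hz ↦ hz)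
  have h4 := (contMDiff_snd_tangentBundle_modelSpace ℝ 𝓘(ℝ, ℝ) (n := ∞)).comp_contMDiffOn h3
  refine (h4.contMDiffAt (huo.mem_nhds hy)).congr_of_eventuallyEq ?_
  filter_upwards [huo.mem_nhds hy] with z hz
  change mfderiv I 𝓘(ℝ, ℝ) f z (X z) = mfderivWithin I 𝓘(ℝ, ℝ) f u z (X z)
  rw [mfderivWithin_of_isOpen huo hz]

theorem smoothField_extend [FiniteDimensional ℝ E] (v : TangentSpace I x) :
    SmoothField (FiberBundle.extend E v : Π y : M, TangentSpace I y) x := by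
  set e := trivializationAt E (TangentSpace I : M → Type _) x
  have h : CMDiff[e.baseSet] ∞ (T% (FiberBundle.extend E v : Π y : M, TangentSpace I y)) := by
    rw [e.contMDiffOn_section_baseSet_iff]
    refine (contMDiffOn_const (c := (e ⟨x, v⟩).2)).congr fun y hy ↦ ?_
    simp [FiberBundle.extend, e, e.apply_mk_symm hy]
  have hx : x ∈ e.baseSet := FiberBundle.mem_baseSet_trivializationAt' x
  filter_upwards [e.open_baseSet.mem_nhds hx] with y hy
  exact h.contMDiffAt (e.open_baseSet.mem_nhds hy)

end Smooth

section Inner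

variable {E : Type*} [NormedAddCommGroup E] [NormedSpace ℝ E] [FiniteDimensional ℝ E]
  {H : Type*} [TopologicalSpace H] {I : ModelWithCorners ℝ E H}
  {M : Type*} [TopologicalSpace M] [ChartedSpace H M] [IsManifold I ∞ M]
  (g : Metric I M) {x : M} {f : M → ℝ} {X Y Z : Π x : M, TangentSpace I x}

omit [FiniteDimensional ℝ E] in
theorem SmoothField.inner (hY : SmoothField Y x) (hZ : SmoothField Z x) :
    SmoothFun I (fun y ↦ g.inner y (Y y) (Z y)) x := by
  filter_upwards [hY, hZ] with y hy hz
  have : ContMDiffAt I (I.prod 𝓘(ℝ)) ∞ (fun m ↦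
      TotalSpace.mk' ℝ (E := Bundle.Trivial M ℝ) m (g.inner m (Y m) (Z m))) y := by
    apply ContMDiffAt.clm_bundle_apply₂ (F₁ := E) (F₂ := E)
    · exact g.contMDiff y
    · exact hy
    · exact hz
  simp only [contMDiffAt_totalSpace] at this
  exact this.2

theorem SmoothField.koszul (hX : SmoothField X x) (hY : SmoothField Y x) (hZ : SmoothField Z x) :
    SmoothFun I (koszul g X Y Z) x :=
  (SmoothFun.const _).mul
    ((((((hY.inner g hZ).dir hX).add ((hZ.inner g hX).dir hY)).sub ((hX.inner g hY).dir hZ)).add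
      ((hX.bracket hY).inner g hZ)).sub ((hY.bracket hZ).inner g hX) |>.add
      ((hZ.bracket hX).inner g hY))

end Inner

/-! ### Smoothness of the Levi-Civita connection -/

section Connection

variable {E : Type*} [NormedAddCommGroup E] [NormedSpace ℝ E]
  {H : Type*} [TopologicalSpace H] {I : ModelWithCorners ℝ E H}
  {M : Type*} [TopologicalSpace M] [ChartedSpace H M]

theorem SmoothFun.of_contDiffAt {F : Type*} [NormedAddCommGroup F] [NormedSpace ℝ F]
    {φ : F → ℝ} {a : M → F} {x : M} (ha : ∀ᶠ y in 𝓝 x, CMDiffAt ∞ a y)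
    (hφ : ∀ᶠ y in 𝓝 x, ContDiffAt ℝ ∞ φ (a y)) : SmoothFun I (fun y ↦ φ (a y)) x := by
  filter_upwards [ha, hφ] with y hy hφy using hφy.contMDiffAt.comp y hy

theorem contDiff_det (ι : Type*) [Fintype ι] [DecidableEq ι] :
    ContDiff ℝ ∞ (fun A : ι → ι → ℝ ↦ (Matrix.of A).det) := by
  simp only [Matrix.det_apply, Matrix.of_apply]
  fun_prop

theorem contDiff_adjugate {ι : Type*} [Fintype ι] [DecidableEq ι] (i j : ι) :
    ContDiff ℝ ∞ (fun A : ι → ι → ℝ ↦ (Matrix.of A).adjugate i j) := by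
  simp only [Matrix.adjugate_apply]
  refine (contDiff_det ι).comp
    (f := fun (A : ι → ι → ℝ) k l ↦ (Matrix.of A).updateRow j (Pi.single i 1) k l) ?_
  refine contDiff_pi.2 fun k ↦ contDiff_pi.2 fun l ↦ ?_
  by_cases h : k = j
  · subst h; simpa using contDiff_const
  · simp only [Matrix.updateRow_ne h, Matrix.of_apply]; fun_prop

/-- The entries of the inverse of a smooth family of invertible matrices are smooth. -/
theorem SmoothFun.matrix_inv {ι : Type*} [Fintype ι] [DecidableEq ι] {A : M → Matrix ι ι ℝ} {x : M}
    (hA : ∀ i j, SmoothFun I (fun y ↦ A y i j) x) (hdet : ∀ᶠ y in 𝓝 x, (A y).det ≠ 0) (i j : ι) :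
    SmoothFun I (fun y ↦ (A y)⁻¹ i j) x := by
  have hA' : ∀ᶠ y in 𝓝 x, ContMDiffAt I 𝓘(ℝ, ι → ι → ℝ) ∞ (fun z i j ↦ A z i j) y := by
    have : ∀ᶠ y in 𝓝 x, ∀ i j, CMDiffAt ∞ (fun y ↦ A y i j) y :=
      eventually_all.2 fun i ↦ eventually_all.2 fun j ↦ hA i j
    filter_upwards [this] with y hy
    exact contMDiffAt_pi_space.2 fun i ↦ contMDiffAt_pi_space.2 fun j ↦ hy i j
  refine SmoothFun.of_contDiffAt (φ := fun B : ι → ι → ℝ ↦ (Matrix.of B)⁻¹ i j)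
    (a := fun z i j ↦ A z i j) hA' ?_
  filter_upwards [hdet] with y hy
  simp only [Matrix.inv_def, Matrix.smul_apply, Ring.inverse_eq_inv', smul_eq_mul]
  exact ((contDiff_det ι).contDiffAt.inv hy).mul (contDiff_adjugate i j).contDiffAt

variable [FiniteDimensional ℝ E] [IsManifold I ∞ M]

/-- Near every point the tangent bundle has a smooth local frame, in which smooth vector fields
have smooth coefficients. -/
theorem exists_smooth_frame (x : M) : ∃ (ι : Type) (_ : Fintype ι) (_ : DecidableEq ι)
    (e : ι → Π y : M, TangentSpace I y),
    (∀ i, SmoothField (e i) x) ∧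
    (∀ᶠ y in 𝓝 x, ∃ b : Basis ι ℝ (TangentSpace I y), ∀ i, b i = e i y) ∧
    (∀ X : Π y : M, TangentSpace I y, SmoothField X x → ∃ c : ι → M → ℝ,
      (∀ i, SmoothFun I (c i) x) ∧ ∀ᶠ y in 𝓝 x, X y = ∑ i, c i y • e i y) := by
  set t := trivializationAt E (TangentSpace I : M → Type _) x
  have hx : x ∈ t.baseSet := FiberBundle.mem_baseSet_trivializationAt' x
  let b := Module.finBasis ℝ E
  have hmem : ∀ᶠ y in 𝓝 x, y ∈ t.baseSet := t.open_baseSet.mem_nhds hx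
  refine ⟨Fin (Module.finrank ℝ E), inferInstance, inferInstance, t.localFrame b, fun i ↦ ?_, ?_,
    fun X hX ↦ ⟨fun i y ↦ t.localFrameCoeff I b i y (X y), fun i ↦ ?_, ?_⟩⟩
  · filter_upwards [hmem] with y hy using contMDiffAt_localFrame_of_mem ∞ _ b i hy
  · filter_upwards [hmem] with y hy
    exact ⟨t.basisAt b hy, fun i ↦ by simp [hy]⟩
  · filter_upwards [hmem, hX] with y hy hXy using contMDiffAt_localFrameCoeff b hy hXy i
  · exact t.eventually_eq_localFrame_sum_coeff_smul b hx

variable (g : Metric I M) {x : M} {f f' : M → ℝ} {X Y Z U V W : Π x : M, TangentSpace I x}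

/-- A vector field is smooth as soon as its inner products with smooth vector fields are: its
coefficients in a frame are obtained from these by inverting the Gram matrix of the frame. -/
theorem SmoothField.of_inner
    (h : ∀ Z : Π x : M, TangentSpace I x, SmoothField Z x →
      SmoothFun I (fun y ↦ g.inner y (V y) (Z y)) x) : SmoothField V x := by
  obtain ⟨ι, _, _, e, he, hb, -⟩ := exists_smooth_frame (I := I) x
  let G : M → Matrix ι ι ℝ := fun y ↦ Matrix.of fun i j ↦ g.inner y (e i y) (e j y)
  have hG : ∀ i j, SmoothFun I (fun y ↦ G y i j) x := fun i j ↦ (he i).inner g (he j)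
  have hdet : ∀ᶠ y in 𝓝 x, (G y).det ≠ 0 := by
    filter_upwards [hb] with y ⟨b, hb⟩
    have := (LinearMap.BilinForm.nondegenerate_iff_det_ne_zero (B := form g y) b).1
      (form_nondegenerate g y)
    convert! this
    ext i j
    simp [G, hb, form]
  have hinv := fun i j ↦ SmoothFun.matrix_inv hG hdet i j
  have hc : SmoothField (fun y ↦ ∑ i, ∑ j, (g.inner y (V y) (e j y) * (G y)⁻¹ j i) • e i y) x :=
    SmoothField.sum fun i _ ↦ SmoothField.sum fun j _ ↦
      SmoothField.smul ((h _ (he j)).mul (hinv j i)) (he i)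
  refine hc.congr ?_
  filter_upwards [hb, hdet] with y ⟨b, hb⟩ hy
  have hV : ∀ j, g.inner y (V y) (e j y) = ∑ k, b.repr (V y) k * G y k j := fun j ↦ by
    conv_lhs => rw [← b.sum_repr (V y)]
    simp [G, hb]
  simp_rw [← Finset.sum_smul]
  conv_lhs => rw [← b.sum_repr (V y)]
  refine Finset.sum_congr rfl fun i _ ↦ ?_
  rw [hb]
  congr 1
  -- the inner products of `V` with the frame are the coefficients times the Gram matrix
  have h1 : (fun j ↦ g.inner y (V y) (e j y)) = Matrix.vecMul (b.repr (V y)) (G y) := by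
    ext j; rw [hV]; rfl
  have h2 : Matrix.vecMul (fun j ↦ g.inner y (V y) (e j y)) (G y)⁻¹ = b.repr (V y) := by
    rw [h1, Matrix.vecMul_vecMul, Matrix.mul_nonsing_inv _ (by simpa using hy), Matrix.vecMul_one]
  exact (congrFun h2 i).symm

/-- The Levi-Civita derivative of a smooth field along a smooth field is smooth. -/
theorem SmoothField.nabla (hX : SmoothField X x) (hY : SmoothField Y x) :
    SmoothField (fun y ↦ leviCivita g Y y (X y)) x := by
  refine SmoothField.of_inner g fun Z hZ ↦ (hX.koszul g hY hZ).congr ?_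
  filter_upwards [hX.eventually, hY.eventually, hZ.eventually] with y hX hY hZ
  exact inner_nabla g hX.mdiff hY.mdiff hZ.mdiff

end Connection

/-! ### Covariant derivatives and curvature of vector fields -/

section Curvature

variable {E : Type*} [NormedAddCommGroup E] [NormedSpace ℝ E] [FiniteDimensional ℝ E]
  {H : Type*} [TopologicalSpace H] {I : ModelWithCorners ℝ E H}
  {M : Type*} [TopologicalSpace M] [ChartedSpace H M] [IsManifold I ∞ M]
  (g : Metric I M) {x : M} {f f' : M → ℝ} {X Y Y' Z U V W : Π x : M, TangentSpace I x}

/-- The covariant derivative `∇_X Y` of a vector field `Y` along a vector field `X`. -/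
noncomputable def cov (X Y : Π x : M, TangentSpace I x) : Π x : M, TangentSpace I x :=
  fun y ↦ leviCivita g Y y (X y)

theorem SmoothField.cov (hX : SmoothField X x) (hY : SmoothField Y x) :
    SmoothField (cov g X Y) x := hX.nabla g hY

theorem cov_congr (hY : SmoothField Y x) (h : ∀ᶠ y in 𝓝 x, Y' y = Y y) :
    cov g X Y' x = cov g X Y x := by
  have := (leviCivita g).isCovariantDerivativeOnUniv.congr_of_eventuallyEq
    (hY.congr h).mdiff hY.mdiff univ_mem h
  exact congr($this (X x))

theorem cov_add_right (hY : SmoothField Y x) (hZ : SmoothField Z x) :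
    cov g X (Y + Z) x = cov g X Y x + cov g X Z x := by
  have := (leviCivita g).isCovariantDerivativeOnUniv.add hY.mdiff hZ.mdiff
  exact congr($this (X x))

theorem cov_smul_right (hf : SmoothFun I f x) (hY : SmoothField Y x) :
    cov g X (f • Y) x = f x • cov g X Y x + d% f x (X x) • Y x := by
  have := (leviCivita g).isCovariantDerivativeOnUniv.leibniz hY.mdiff hf.mdiff
  simpa using! congr($this (X x))

theorem cov_sub_right (hY : SmoothField Y x) (hZ : SmoothField Z x) :
    cov g X (Y - Z) x = cov g X Y x - cov g X Z x := by
  have := cov_add_right g (X := X) (hY.sub hZ) hZ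
  rw [sub_add_cancel] at this
  rw [this, add_sub_cancel_right]

theorem cov_add_left : cov g (X + Z) Y x = cov g X Y x + cov g Z Y x := by simp [cov]

theorem cov_smul_left : cov g (f • X) Y x = f x • cov g X Y x := by simp [cov]

theorem cov_sub_cov (hX : SmoothField X x) (hY : SmoothField Y x) :
    cov g X Y x - cov g Y X x = mlieBracket I X Y x :=
  (CovariantDerivative.torsion_eq_zero_iff (leviCivita g)).1 (leviCivita_torsion g)
    hX.mdiff hY.mdiff

theorem dir_inner (hX : SmoothField X x) (hY : SmoothField Y x) (hZ : SmoothField Z x) :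
    d% (fun y ↦ g.inner y (Y y) (Z y)) x (X x)
      = g.inner x (cov g X Y x) (Z x) + g.inner x (Y x) (cov g X Z x) :=
  leviCivita_metric g hX.mdiff hY.mdiff hZ.mdiff

omit [FiniteDimensional ℝ E] [IsManifold I ∞ M] in
theorem dir_congr (h : ∀ᶠ y in 𝓝 x, f' y = f y) : d% f' x (X x) = d% f x (X x) := by
  have h' : f' =ᶠ[𝓝 x] f := h
  change mfderiv I 𝓘(ℝ, ℝ) f' x (X x) = mfderiv I 𝓘(ℝ, ℝ) f x (X x)
  rw [h'.mfderiv_eq]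
  rfl

theorem jacobi (hU : SmoothField U x) (hV : SmoothField V x) (hW : SmoothField W x) :
    mlieBracket I U (mlieBracket I V W) x =
      mlieBracket I (mlieBracket I U V) W x + mlieBracket I V (mlieBracket I U W) x := by
  have : IsManifold I (minSmoothness ℝ 3) M := by
    simpa using (inferInstance : IsManifold I 3 M)
  have h2 : minSmoothness ℝ 2 ≤ ∞ := by simpa using ENat.LEInfty.out
  exact leibniz_identity_mlieBracket_apply (hU.self_of_nhds.of_le h2) (hV.self_of_nhds.of_le h2)
    (hW.self_of_nhds.of_le h2)

theorem jacobi_cyclic (hU : SmoothField U x) (hV : SmoothField V x) (hW : SmoothField W x) :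
    mlieBracket I U (mlieBracket I V W) x + mlieBracket I V (mlieBracket I W U) x
      + mlieBracket I W (mlieBracket I U V) x = 0 := by
  have h : mlieBracket I U W = (-1 : ℝ) • mlieBracket I W U := by
    rw [mlieBracket_swap, neg_one_smul]
  rw [jacobi hU hV hW, mlieBracket_swap_apply (V := mlieBracket I U V), h,
    mlieBracket_const_smul_right (hW.bracket hU).mdiff]
  module

/-- The Lie bracket of vector fields acts on functions as a commutator. This follows from the
Jacobi identity for `U`, `V` and `f • W` and the Leibniz rule, where `W` does not vanish at `x`. -/
theorem dir_bracket (hf : SmoothFun I f x) (hU : SmoothField U x) (hV : SmoothField V x) :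
    d% f x (mlieBracket I U V x)
      = d% (fun y ↦ d% f y (V y)) x (U x) - d% (fun y ↦ d% f y (U y)) x (V x) := by
  rcases subsingleton_or_nontrivial (TangentSpace I x) with h | h
  · rw [Subsingleton.elim (mlieBracket I U V x) 0, Subsingleton.elim (U x) 0,
      Subsingleton.elim (V x) 0]
    simp
  obtain ⟨w, hw⟩ := exists_ne (0 : TangentSpace I x)
  have hW := smoothField_extend w
  have hWx : (FiberBundle.extend E w : Π y : M, TangentSpace I y) x = w :=
    FiberBundle.extend_apply_self E w
  generalize (FiberBundle.extend E w : Π y : M, TangentSpace I y) = W at hW hWx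
  have expand : ∀ {A B : Π y : M, TangentSpace I y}, SmoothField A x → SmoothField B x →
      mlieBracket I A (mlieBracket I B (f • W)) x
        = d% (fun y ↦ d% f y (B y)) x (A x) • W x + d% f x (B x) • mlieBracket I A W x
          + d% f x (A x) • mlieBracket I B W x + f x • mlieBracket I A (mlieBracket I B W) x := by
    intro A B hA hB
    have h1 : mlieBracket I B (f • W) =ᶠ[𝓝 x]
        ((fun y ↦ d% f y (B y)) • W + f • mlieBracket I B W) := by
      filter_upwards [hf.eventually, hW.eventually] with y hfy hWy
      exact mlieBracket_smul_right hfy.mdiff hWy.mdiff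
    rw [(EventuallyEq.refl _ A).mlieBracket_vectorField_eq h1,
      mlieBracket_add_right (SmoothField.smul (hf.dir hB) hW).mdiff
        (SmoothField.smul hf (hB.bracket hW)).mdiff,
      mlieBracket_smul_right (hf.dir hB).mdiff hW.mdiff,
      mlieBracket_smul_right hf.mdiff (hB.bracket hW).mdiff]
    abel
  have hj := jacobi hU hV (SmoothField.smul hf hW)
  rw [expand hU hV, expand hV hU, mlieBracket_smul_right hf.mdiff hW.mdiff, jacobi hU hV hW] at hj
  have : (d% f x (mlieBracket I U V x) - (d% (fun y ↦ d% f y (V y)) x (U x)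
      - d% (fun y ↦ d% f y (U y)) x (V x))) • w = 0 := by
    rw [← hWx]
    linear_combination (norm := module) (-1 : ℝ) • hj
  exact sub_eq_zero.1 ((smul_eq_zero.1 this).resolve_right hw)

/-- The curvature `R(U,V)W = ∇_U ∇_V W - ∇_V ∇_U W - ∇_{[U,V]} W` of vector fields. -/
noncomputable def curv (U V W : Π x : M, TangentSpace I x) : Π x : M, TangentSpace I x :=
  cov g U (cov g V W) - cov g V (cov g U W) - cov g (mlieBracket I U V) W

theorem curv_apply : curv g U V W x = cov g U (cov g V W) x - cov g V (cov g U W) x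
    - cov g (mlieBracket I U V) W x := rfl

theorem SmoothField.curv (hU : SmoothField U x) (hV : SmoothField V x) (hW : SmoothField W x) :
    SmoothField (curv g U V W) x :=
  ((hU.cov g (hV.cov g hW)).sub (hV.cov g (hU.cov g hW))).sub ((hU.bracket hV).cov g hW)

theorem curv_swap : curv g V U W x = -curv g U V W x := by
  simp only [curv_apply, cov, mlieBracket_swap_apply (V := V) (W := U), map_neg]
  abel

/-- The first Bianchi identity. -/
theorem curv_bianchi (hU : SmoothField U x) (hV : SmoothField V x) (hW : SmoothField W x) :
    curv g U V W x + curv g V W U x + curv g W U V x = 0 := by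
  have key : ∀ {A B C : Π y : M, TangentSpace I y}, SmoothField A x → SmoothField B x →
      SmoothField C x → cov g A (cov g B C) x - cov g A (cov g C B) x
        - cov g (mlieBracket I B C) A x = mlieBracket I A (mlieBracket I B C) x := by
    intro A B C hA hB hC
    rw [← cov_sub_right g (hB.cov g hC) (hC.cov g hB), ← cov_sub_cov g hA (hB.bracket hC),
      cov_congr g (hB.bracket hC)]
    filter_upwards [hB.eventually, hC.eventually] with y hB hC using cov_sub_cov g hB hC
  have h1 := key hU hV hW
  have h2 := key hV hW hU
  have h3 := key hW hU hV
  have hj := jacobi_cyclic hU hV hW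
  simp only [curv_apply]
  linear_combination (norm := module) h1 + h2 + h3 + hj

/-- The curvature operator is skew-adjoint: `2 g(R(U,V)W, W)` is the expression
`U(V f) - V(U f) - [U,V] f` for `f = g(W,W)`. -/
theorem inner_curv_self (hU : SmoothField U x) (hV : SmoothField V x) (hW : SmoothField W x) :
    g.inner x (curv g U V W x) (W x) = 0 := by
  have key : ∀ {A B : Π y : M, TangentSpace I y}, SmoothField A x → SmoothField B x →
      d% (fun y ↦ d% (fun y ↦ g.inner y (W y) (W y)) y (B y)) x (A x)
        = 2 * (g.inner x (cov g A (cov g B W) x) (W x)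
          + g.inner x (cov g B W x) (cov g A W x)) := by
    intro A B hA hB
    have : ∀ᶠ y in 𝓝 x, d% (fun y ↦ g.inner y (W y) (W y)) y (B y)
        = g.inner y (cov g B W y) (W y) + g.inner y (cov g B W y) (W y) := by
      filter_upwards [hB.eventually, hW.eventually] with y hB hW
      rw [dir_inner g hB hW hW, g.symm y (W y)]
    have hs := (hB.cov g hW).inner g hW
    rw [dir_congr this, mvfderiv_fun_add hs.mdiff hs.mdiff, add_apply,
      dir_inner g hA (hB.cov g hW) hW]
    ring
  have h := dir_bracket (hW.inner g hW) hU hV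
  rw [key hU hV, key hV hU, dir_inner g (hU.bracket hV) hW hW,
    g.symm x (W x), g.symm x (cov g U W x)] at h
  simp only [curv_apply, map_sub, sub_apply]
  linarith

/-- The second Bianchi identity, in a form without the covariant derivative of the curvature
tensor. -/
theorem curv_bianchi₂ (hU : SmoothField U x) (hV : SmoothField V x) (hZ : SmoothField Z x)
    (hW : SmoothField W x) :
    (cov g U (curv g V Z W) x - curv g V Z (cov g U W) x - curv g (mlieBracket I V Z) U W x)
    + (cov g V (curv g Z U W) x - curv g Z U (cov g V W) x - curv g (mlieBracket I Z U) V W x)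
    + (cov g Z (curv g U V W) x - curv g U V (cov g Z W) x - curv g (mlieBracket I U V) Z W x)
      = 0 := by
  have key : ∀ {A B C : Π y : M, TangentSpace I y}, SmoothField A x → SmoothField B x →
      SmoothField C x → cov g A (curv g B C W) x = cov g A (cov g B (cov g C W)) x
        - cov g A (cov g C (cov g B W)) x - cov g A (cov g (mlieBracket I B C) W) x := by
    intro A B C hA hB hC
    rw [curv, cov_sub_right g ((hB.cov g (hC.cov g hW)).sub (hC.cov g (hB.cov g hW)))
      ((hB.bracket hC).cov g hW), cov_sub_right g (hB.cov g (hC.cov g hW))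
      (hC.cov g (hB.cov g hW))]
  have hj := jacobi_cyclic hU hV hZ
  rw [mlieBracket_swap_apply (V := U), mlieBracket_swap_apply (V := V),
    mlieBracket_swap_apply (V := Z)] at hj
  have hj' := congr(leviCivita g W x $hj)
  simp only [map_neg, map_add, map_zero] at hj'
  rw [key hU hV hZ, key hV hZ hU, key hZ hU hV]
  simp only [curv_apply]
  simp only [cov] at hj' ⊢
  linear_combination (norm := module) -hj'

end Curvature

/-! ### Tensoriality and symmetries of the curvature -/

section Tensor

variable {E : Type*} [NormedAddCommGroup E] [NormedSpace ℝ E] [FiniteDimensional ℝ E]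
  {H : Type*} [TopologicalSpace H] {I : ModelWithCorners ℝ E H}
  {M : Type*} [TopologicalSpace M] [ChartedSpace H M] [IsManifold I ∞ M]
  (g : Metric I M) {x : M} {f : M → ℝ} {X Y U U' V V' W W' C : Π x : M, TangentSpace I x}

/-- An operation on vector fields smooth near `x` is tensorial at `x` if it is additive and
commutes with multiplication by functions smooth near `x`. Unlike Mathlib's `TensorialAt`, this
applies to second-order operations such as the curvature. -/
structure SmoothTensorialAt {A : Type*} [AddCommGroup A] [Module ℝ A]
    (Φ : (Π y : M, TangentSpace I y) → A) (x : M) : Prop where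
  smul : ∀ {f : M → ℝ} {X : Π y : M, TangentSpace I y}, SmoothFun I f x → SmoothField X x →
    Φ (f • X) = f x • Φ X
  add : ∀ {X Y : Π y : M, TangentSpace I y}, SmoothField X x → SmoothField Y x →
    Φ (X + Y) = Φ X + Φ Y

namespace SmoothTensorialAt

variable {A : Type*} [AddCommGroup A] [Module ℝ A] {Φ : (Π y : M, TangentSpace I y) → A}

omit [FiniteDimensional ℝ E] in
theorem congr (hΦ : SmoothTensorialAt Φ x) (hX : SmoothField X x)
    (h : ∀ᶠ y in 𝓝 x, Y y = X y) : Φ Y = Φ X := by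
  classical
  -- multiply both fields by the indicator function of the set where they agree
  let ψ (y : M) : ℝ := if Y y = X y then 1 else 0
  have hψx : ψ x = 1 := by simp [ψ, h.self_of_nhds]
  have hψ : SmoothFun I ψ x :=
    (SmoothFun.const 1).congr (h.mono fun y hy ↦ by simp [ψ, hy])
  have he : ψ • Y = ψ • X := by
    ext y
    by_cases hy : Y y = X y <;> simp [ψ, hy]
  have h1 := hΦ.smul hψ (hX.congr h)
  rw [he, hΦ.smul hψ hX, hψx, one_smul, one_smul] at h1
  exact h1.symm

omit [FiniteDimensional ℝ E] in
theorem sum (hΦ : SmoothTensorialAt Φ x) {ι : Type*} {s : Finset ι}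
    {X : ι → Π y : M, TangentSpace I y} (hX : ∀ i ∈ s, SmoothField (X i) x) :
    Φ (∑ i ∈ s, X i) = ∑ i ∈ s, Φ (X i) := by
  classical
  induction s using Finset.induction_on with
  | empty =>
    have h := hΦ.smul (f := fun _ ↦ 0) (X := 0) (SmoothFun.const 0)
      (Eventually.of_forall fun y ↦ (contMDiff_zeroSection ℝ (TangentSpace I) (F := E)) y)
    simpa using h
  | insert a s ha ih =>
    have h1 := hX a (Finset.mem_insert_self a s)
    have h2 : ∀ i ∈ s, SmoothField (X i) x := fun i hi ↦ hX i (Finset.mem_insert_of_mem hi)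
    have h3 : SmoothField (∑ i ∈ s, X i) x :=
      (SmoothField.sum h2).congr (Eventually.of_forall fun y ↦ by simp)
    rw [Finset.sum_insert ha, Finset.sum_insert ha, hΦ.add h1 h3, ih h2]

/-- A tensorial operation depends only on the value of the vector field at `x`: expand the field in
a smooth local frame. -/
theorem pointwise (hΦ : SmoothTensorialAt Φ x) (hX : SmoothField X x) (hY : SmoothField Y x)
    (h : X x = Y x) : Φ X = Φ Y := by
  obtain ⟨ι, _, _, e, he, hb, hc⟩ := exists_smooth_frame (I := I) x
  have expand : ∀ {Z : Π y : M, TangentSpace I y}, SmoothField Z x → ∃ c : ι → ℝ,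
      Z x = ∑ i, c i • e i x ∧ Φ Z = ∑ i, c i • Φ (e i) := by
    intro Z hZ
    obtain ⟨c, hc, hZc⟩ := hc Z hZ
    refine ⟨fun i ↦ c i x, hZc.self_of_nhds, ?_⟩
    have hs : ∀ i ∈ Finset.univ, SmoothField (c i • e i) x := fun i _ ↦ .smul (hc i) (he i)
    have hs' : SmoothField (∑ i, c i • e i) x :=
      (SmoothField.sum hs).congr (Eventually.of_forall fun y ↦ by simp)
    rw [hΦ.congr hs' (hZc.mono fun y hy ↦ by simp [hy]), hΦ.sum hs]
    exact Finset.sum_congr rfl fun i _ ↦ hΦ.smul (hc i) (he i)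
  obtain ⟨c, hcX, hΦX⟩ := expand hX
  obtain ⟨d, hdY, hΦY⟩ := expand hY
  obtain ⟨b, hb⟩ := hb.self_of_nhds
  have hcd : c = d := by
    have h' : ∑ i, c i • b i = ∑ i, d i • b i := by simp only [hb, ← hcX, ← hdY, h]
    rw [← b.repr_sum_self c, h', b.repr_sum_self]
  rw [hΦX, hΦY, hcd]

end SmoothTensorialAt

theorem curv_tensorial_right (hU : SmoothField U x) (hV : SmoothField V x) :
    SmoothTensorialAt (fun W ↦ curv g U V W x) x where
  smul {f W} hf hW := by
    have key : ∀ {A B : Π y : M, TangentSpace I y}, SmoothField A x → SmoothField B x →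
        cov g A (cov g B (f • W)) x = f x • cov g A (cov g B W) x + d% f x (A x) • cov g B W x
          + (d% f x (B x) • cov g A W x + d% (fun y ↦ d% f y (B y)) x (A x) • W x) := by
      intro A B hA hB
      have h1 : ∀ᶠ y in 𝓝 x, cov g B (f • W) y
          = (f • cov g B W + (fun y ↦ d% f y (B y)) • W) y := by
        filter_upwards [hf.eventually, hW.eventually] with y hf hW using cov_smul_right g hf hW
      have h2 := SmoothField.smul hf (hB.cov g hW)
      have h3 := SmoothField.smul (hf.dir hB) hW
      rw [cov_congr g (h2.add h3) h1, cov_add_right g h2 h3, cov_smul_right g hf (hB.cov g hW),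
        cov_smul_right g (hf.dir hB) hW]
    simp only [curv_apply]
    rw [key hU hV, key hV hU, cov_smul_right g hf hW, dir_bracket hf hU hV]
    module
  add {W W'} hW hW' := by
    have key : ∀ {A B : Π y : M, TangentSpace I y}, SmoothField B x →
        cov g A (cov g B (W + W')) x = cov g A (cov g B W) x + cov g A (cov g B W') x := by
      intro A B hB
      rw [← cov_add_right g (hB.cov g hW) (hB.cov g hW'),
        cov_congr g ((hB.cov g hW).add (hB.cov g hW'))]
      filter_upwards [hW.eventually, hW'.eventually] with y hW hW' using cov_add_right g hW hW'
    simp only [curv_apply]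
    rw [key hV, key hU, cov_add_right g hW hW']
    module

theorem curv_tensorial_left (hW : SmoothField W x) :
    SmoothTensorialAt (fun U ↦ curv g U V W x) x where
  smul {f U} hf hU := by
    have h1 : cov g V (cov g (f • U) W) x
        = f x • cov g V (cov g U W) x + d% f x (V x) • cov g U W x := by
      rw [← cov_smul_right g hf (hU.cov g hW)]
      exact cov_congr g (.smul hf (hU.cov g hW)) (Eventually.of_forall fun y ↦ cov_smul_left g)
    have h2 : cov g (mlieBracket I (f • U) V) W x
        = f x • cov g (mlieBracket I U V) W x - d% f x (V x) • cov g U W x := by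
      simp only [cov, mlieBracket_smul_left hf.mdiff hU.mdiff, map_add, map_smul, map_neg, neg_smul]
      abel
    simp only [curv_apply]
    rw [h1, h2, cov_smul_left]
    module
  add {U U'} hU hU' := by
    have h1 : cov g V (cov g (U + U') W) x = cov g V (cov g U W) x + cov g V (cov g U' W) x := by
      rw [← cov_add_right g (hU.cov g hW) (hU'.cov g hW)]
      exact cov_congr g ((hU.cov g hW).add (hU'.cov g hW))
        (Eventually.of_forall fun y ↦ cov_add_left g)
    have h2 : cov g (mlieBracket I (U + U') V) W x
        = cov g (mlieBracket I U V) W x + cov g (mlieBracket I U' V) W x := by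
      simp only [cov, mlieBracket_add_left hU.mdiff hU'.mdiff, map_add]
    simp only [curv_apply]
    rw [h1, h2, cov_add_left]
    module

/-- The curvature tensor can be computed from arbitrary extensions to smooth vector fields. -/
theorem curvatureOp_eq (hU : SmoothField U x) (hV : SmoothField V x) (hW : SmoothField W x) :
    curvatureOp g x (U x) (V x) (W x) = curv g U V W x := by
  have eU := smoothField_extend (U x)
  have eV := smoothField_extend (V x)
  have eW := smoothField_extend (W x)
  change curv g (FiberBundle.extend E (U x)) (FiberBundle.extend E (V x))
    (FiberBundle.extend E (W x)) x = _
  rw [(curv_tensorial_right g eU eV).pointwise eW hW (by simp),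
    (curv_tensorial_left g hW).pointwise eU hU (by simp), ← neg_inj, ← curv_swap, ← curv_swap,
    (curv_tensorial_left g hW).pointwise eV hV (by simp)]

theorem riemann_eq (hU : SmoothField U x) (hV : SmoothField V x) (hW : SmoothField W x)
    (c : TangentSpace I x) :
    riemann g x (U x) (V x) c (W x) = g.inner x (curv g U V W x) c := by
  rw [riemann, curvatureOp_eq g hU hV hW]

theorem exists_smoothField (v : TangentSpace I x) :
    ∃ X : Π y : M, TangentSpace I y, SmoothField X x ∧ X x = v :=
  ⟨_, smoothField_extend v, FiberBundle.extend_apply_self E v⟩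

end Tensor

/-- An algebraic curvature tensor on a real vector space. Multilinearity is only required in the
first argument, since it follows for the others by symmetry. -/
structure IsAlgCurv {V : Type*} [AddCommGroup V] [Module ℝ V] (T : V → V → V → V → ℝ) : Prop where
  add_left : ∀ a a' b c d, T (a + a') b c d = T a b c d + T a' b c d
  smul_left : ∀ (r : ℝ) a b c d, T (r • a) b c d = r * T a b c d
  swap_left : ∀ a b c d, T b a c d = -T a b c d
  swap_right : ∀ a b c d, T a b d c = -T a b c d
  bianchi : ∀ a b c d, T a b c d + T b d c a + T d a c b = 0

section

variable {E : Type*} [NormedAddCommGroup E] [NormedSpace ℝ E] [FiniteDimensional ℝ E]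
  {H : Type*} [TopologicalSpace H] {I : ModelWithCorners ℝ E H}
  {M : Type*} [TopologicalSpace M] [ChartedSpace H M] [IsManifold I ∞ M]
  (g : Metric I M)

/-- The Riemann tensor has the symmetries of an algebraic curvature tensor. -/
theorem isAlgCurv_riemann (x : M) : IsAlgCurv (riemann g x) where
  add_left a a' b c d := by
    obtain ⟨U, hU, rfl⟩ := exists_smoothField a
    obtain ⟨U', hU', rfl⟩ := exists_smoothField a'
    obtain ⟨V, hV, rfl⟩ := exists_smoothField b
    obtain ⟨W, hW, rfl⟩ := exists_smoothField d
    rw [riemann_eq g hU hV hW, riemann_eq g hU' hV hW, ← Pi.add_apply,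
      riemann_eq g (hU.add hU') hV hW, (curv_tensorial_left g hW).add hU hU']
    simp
  smul_left r a b c d := by
    obtain ⟨U, hU, rfl⟩ := exists_smoothField a
    obtain ⟨V, hV, rfl⟩ := exists_smoothField b
    obtain ⟨W, hW, rfl⟩ := exists_smoothField d
    have hr : SmoothFun I (fun _ : M ↦ r) x := SmoothFun.const r
    have h := riemann_eq g (SmoothField.smul hr hU) hV hW c
    rw [(curv_tensorial_left g hW).smul hr hU] at h
    rw [riemann_eq g hU hV hW]
    simpa using h
  swap_left a b c d := by
    obtain ⟨U, hU, rfl⟩ := exists_smoothField a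
    obtain ⟨V, hV, rfl⟩ := exists_smoothField b
    obtain ⟨W, hW, rfl⟩ := exists_smoothField d
    rw [riemann_eq g hU hV hW, riemann_eq g hV hU hW, curv_swap]
    simp
  swap_right a b c d := by
    obtain ⟨U, hU, rfl⟩ := exists_smoothField a
    obtain ⟨V, hV, rfl⟩ := exists_smoothField b
    obtain ⟨C, hC, rfl⟩ := exists_smoothField c
    obtain ⟨W, hW, rfl⟩ := exists_smoothField d
    have h := inner_curv_self g hU hV (hC.add hW)
    rw [(curv_tensorial_right g hU hV).add hC hW] at h
    rw [riemann_eq g hU hV hW, riemann_eq g hU hV hC]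
    have h1 := inner_curv_self g hU hV hC
    have h2 := inner_curv_self g hU hV hW
    simp only [Pi.add_apply, map_add, add_apply] at h
    linarith
  bianchi a b c d := by
    obtain ⟨U, hU, rfl⟩ := exists_smoothField a
    obtain ⟨V, hV, rfl⟩ := exists_smoothField b
    obtain ⟨W, hW, rfl⟩ := exists_smoothField d
    rw [riemann_eq g hU hV hW, riemann_eq g hV hW hU, riemann_eq g hW hU hV,
      ← add_apply, ← map_add, ← add_apply, ← map_add, curv_bianchi g hU hV hW]
    simp

end

/-! ### Algebraic curvature tensors -/

section Algebra

variable {V : Type*} [AddCommGroup V] [Module ℝ V] {T T' : V → V → V → V → ℝ}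

variable {n : ℕ} {B : LinearMap.BilinForm ℝ V} {e : Basis (Fin n) ℝ V}

theorem eq_sum_of_orthonormal (he : ∀ i j, B (e i) (e j) = if i = j then 1 else 0)
    (v : V) : v = ∑ i, B v (e i) • e i := by
  conv_lhs => rw [← e.sum_repr v]
  refine Finset.sum_congr rfl fun i _ ↦ ?_
  congr 1
  conv_rhs => rw [← e.sum_repr v]
  simp [he, -Basis.sum_repr]

namespace IsAlgCurv

/-- The pair symmetry follows by combining the four Bianchi identities obtained by permuting the
arguments cyclically. -/
theorem pair_symm (h : IsAlgCurv T) (a b c d : V) : T a b c d = T c d a b := by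
  linarith [h.bianchi a b c d, h.bianchi b c d a, h.bianchi c d a b, h.bianchi d a b c,
    h.swap_left a c d b, h.swap_left b d c a, h.swap_right a b c d, h.swap_right b c a d,
    h.swap_right c d a b, h.swap_right d a b c, h.swap_right a c b d, h.swap_right d b a c]

theorem add_second (h : IsAlgCurv T) (a b b' c d : V) :
    T a (b + b') c d = T a b c d + T a b' c d := by
  rw [h.swap_left, h.add_left, h.swap_left a b, h.swap_left a b']; ring

theorem smul_second (h : IsAlgCurv T) (r : ℝ) (a b c d : V) :
    T a (r • b) c d = r * T a b c d := by
  rw [h.swap_left, h.smul_left, h.swap_left a b]; ring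

theorem add_third (h : IsAlgCurv T) (a b c c' d : V) :
    T a b (c + c') d = T a b c d + T a b c' d := by
  rw [h.pair_symm, h.add_left, h.pair_symm a b c, h.pair_symm a b c']

theorem smul_third (h : IsAlgCurv T) (r : ℝ) (a b c d : V) :
    T a b (r • c) d = r * T a b c d := by
  rw [h.pair_symm, h.smul_left, h.pair_symm a b c]

theorem add_fourth (h : IsAlgCurv T) (a b c d d' : V) :
    T a b c (d + d') = T a b c d + T a b c d' := by
  rw [h.pair_symm, h.add_second, h.pair_symm a b c, h.pair_symm a b c]

theorem smul_fourth (h : IsAlgCurv T) (r : ℝ) (a b c d : V) :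
    T a b c (r • d) = r * T a b c d := by
  rw [h.pair_symm, h.smul_second, h.pair_symm a b c]

theorem self_left (h : IsAlgCurv T) (a c d : V) : T a a c d = 0 := by
  linarith [h.swap_left a a c d]

theorem sub (h : IsAlgCurv T) (h' : IsAlgCurv T') :
    IsAlgCurv fun a b c d ↦ T a b c d - T' a b c d where
  add_left a a' b c d := by rw [h.add_left, h'.add_left]; ring
  smul_left r a b c d := by rw [h.smul_left, h'.smul_left]; ring
  swap_left a b c d := by rw [h.swap_left, h'.swap_left]; ring
  swap_right a b c d := by rw [h.swap_right, h'.swap_right]; ring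
  bianchi a b c d := by linarith [h.bianchi a b c d, h'.bianchi a b c d]

/-- An algebraic curvature tensor is determined by its sectional curvatures. -/
theorem eq_zero (h : IsAlgCurv T) (h0 : ∀ u v, T u v u v = 0) (a b c d : V) : T a b c d = 0 := by
  have h1 : ∀ a b d, T a b a d = 0 := fun a b d ↦ by
    have := h0 a (b + d)
    rw [h.add_second, h.add_fourth, h.add_fourth, h0, h0, h.pair_symm a d a b] at this
    linarith
  have h2 : ∀ a b c d, T a b c d = -T c b a d := fun a b c d ↦ by
    have := h1 (a + c) b d
    rw [h.add_left, h.add_third, h.add_third, h1, h1] at this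
    linarith
  linarith [h.bianchi a b c d, h2 b d c a, h.swap_right c d a b, h.pair_symm c d a b, h.swap_left a
    d c b, h2 a d c b]

theorem eq_of_sectional (h : IsAlgCurv T) (h' : IsAlgCurv T') (h0 : ∀ u v, T u v u v = T' u v u v)
    (a b c d : V) : T a b c d = T' a b c d :=
  sub_eq_zero.1 ((h.sub h').eq_zero (fun u v ↦ sub_eq_zero.2 (h0 u v)) a b c d)

/-- The curvature tensor `κ (B_{ac} B_{bd} - B_{ad} B_{bc})` of constant curvature `κ`. -/
theorem const (B : LinearMap.BilinForm ℝ V) (hB : ∀ v w, B v w = B w v) (κ : ℝ) :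
    IsAlgCurv fun a b c d ↦ κ * (B a c * B b d - B a d * B b c) where
  add_left a a' b c d := by simp; ring
  smul_left r a b c d := by simp; ring
  swap_left a b c d := by ring
  swap_right a b c d := by ring
  bianchi a b c d := by rw [hB b a, hB d a, hB d b]; ring

theorem sum_left (h : IsAlgCurv T) (he : ∀ i j, B (e i) (e j) = if i = j then 1 else 0)
    (v b c d : V) : ∑ i, B v (e i) * T (e i) b c d = T v b c d := by
  let l : V →ₗ[ℝ] ℝ :=
    { toFun := fun a ↦ T a b c d
      map_add' := fun a a' ↦ h.add_left a a' b c d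
      map_smul' := fun r a ↦ h.smul_left r a b c d }
  have := congrArg l (eq_sum_of_orthonormal he v)
  simpa [l] using this.symm

/-- If all infinitesimal rotations `v ↦ B(v,q) p - B(v,p) q` annihilate an algebraic curvature
tensor, then it is of constant curvature. One contraction expresses the tensor through its Ricci
contraction, and a second one shows the latter to be a multiple of `B`. -/
theorem exists_const (h : IsAlgCurv T) (hB : ∀ v w, B v w = B w v) (hn : 2 ≤ n)
    (he : ∀ i j, B (e i) (e j) = if i = j then 1 else 0)
    (hrot : ∀ p q a b c d, T (B a q • p - B a p • q) b c d + T a (B b q • p - B b p • q) c d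
      + T a b (B c q • p - B c p • q) d + T a b c (B d q • p - B d p • q) = 0) :
    ∃ κ : ℝ, ∀ a b c d, T a b c d = κ * (B a c * B b d - B a d * B b c) := by
  have hn1 : (n : ℝ) - 1 ≠ 0 := by
    have : (2 : ℝ) ≤ n := by exact_mod_cast hn
    linarith
  have hn0 : (n : ℝ) ≠ 0 := by positivity
  -- the contraction of the first and third argument
  let Ric : V → V → ℝ := fun b d ↦ ∑ i, T (e i) b (e i) d
  have h1 : ∀ p b c d, ((n : ℝ) - 1) * T p b c d = B c p * Ric b d - B d p * Ric b c := by
    intro p b c d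
    -- the rotation in the plane of `p` and `e i`, applied in the entry `a = e i`
    have hi : ∀ i, T p b c d - B p (e i) * T (e i) b c d
        + B b (e i) * T (e i) p c d + B c (e i) * T (e i) b p d - B c p * T (e i) b (e i) d
        + B d (e i) * T (e i) b c p + B d p * T (e i) b (e i) c = 0 := by
      intro i
      have := hrot p (e i) (e i) b c d
      simp only [sub_eq_add_neg, ← neg_smul, h.add_left, h.add_second, h.add_third, h.add_fourth,
        h.smul_left, h.smul_second, h.smul_third, h.smul_fourth, he, if_true] at this
      rw [h.self_left, hB (e i) p, h.swap_right (e i) b (e i) c] at this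
      linarith
    have hs := Finset.sum_congr (rfl : (Finset.univ : Finset (Fin n)) = Finset.univ)
      (fun i _ ↦ hi i)
    simp only [Finset.sum_add_distrib, Finset.sum_sub_distrib, ← Finset.mul_sum,
      h.sum_left he, Finset.sum_const, Finset.card_univ, Fintype.card_fin, nsmul_eq_mul,
      mul_zero] at hs
    simp only [Ric]
    linarith [h.pair_symm c b p d, h.bianchi b p c d]
  have h2 : ∀ p c, (n : ℝ) * Ric p c = (∑ j, Ric (e j) (e j)) * B c p := by
    intro p c
    have hj := Finset.sum_congr (rfl : (Finset.univ : Finset (Fin n)) = Finset.univ)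
      (fun j _ ↦ h1 p (e j) c (e j))
    have hRic : ∑ j, T p (e j) c (e j) = Ric p c := Finset.sum_congr rfl fun j _ ↦ by
      rw [h.swap_left, h.swap_right, neg_neg]
    have hlin : ∑ j, B (e j) p * Ric (e j) c = Ric p c := by
      simp only [Ric, Finset.mul_sum]
      rw [Finset.sum_comm]
      refine Finset.sum_congr rfl fun i _ ↦ ?_
      have := h.sum_left he p (e i) c (e i)
      rw [h.swap_left, h.swap_right, neg_neg, ← this]
      refine Finset.sum_congr rfl fun j _ ↦ ?_
      rw [hB, h.swap_left (e i), h.swap_right (e i)]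
    rw [← Finset.mul_sum, hRic, Finset.sum_sub_distrib, hlin, ← Finset.mul_sum] at hj
    linarith
  refine ⟨(∑ j, Ric (e j) (e j)) / (n * (n - 1)), fun a b c d ↦ ?_⟩
  have h3 := h1 a b c d
  have h4 := h2 b d
  have h5 := h2 b c
  rw [hB c a, hB d a] at h3
  rw [hB d b] at h4
  rw [hB c b] at h5
  have : (n : ℝ) * ((n - 1) * T a b c d)
      = (∑ j, Ric (e j) (e j)) * (B a c * B b d - B a d * B b c) := by
    rw [h3]; linear_combination B a c * h4 - B a d * h5
  field_simp
  linarith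

end IsAlgCurv

/-- A finite-dimensional Euclidean vector space has an orthonormal basis. -/
theorem exists_orthonormal_basis [FiniteDimensional ℝ V] (B : LinearMap.BilinForm ℝ V)
    (hB : ∀ v w, B v w = B w v) (hpos : ∀ v, v ≠ 0 → 0 < B v v) {n : ℕ} (hn : finrank ℝ V = n) :
    ∃ e : Basis (Fin n) ℝ V, ∀ i j, B (e i) (e j) = if i = j then 1 else 0 := by
  let core : InnerProductSpace.Core ℝ V :=
    { inner := fun v w ↦ B v w
      conj_inner_symm := fun v w ↦ hB w v
      re_inner_nonneg := fun v ↦ by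
        rcases eq_or_ne v 0 with rfl | h
        · simp
        · exact (hpos v h).le
      add_left := fun a b c ↦ by simp
      smul_left := fun a b c ↦ by simp
      definite := fun v hv ↦ by
        by_contra h
        exact (hpos v h).ne' hv }
  let : NormedAddCommGroup V := core.toNormedAddCommGroup
  let : InnerProductSpace ℝ V := InnerProductSpace.ofCore core.toCore
  let b := (stdOrthonormalBasis ℝ V).reindex (finCongr hn)
  refine ⟨b.toBasis, fun i j ↦ ?_⟩
  rw [OrthonormalBasis.coe_toBasis]
  exact orthonormal_iff_ite.1 b.orthonormal i j

end Algebra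

/-! ### Schur's lemma -/

section Schur

variable {E : Type*} [NormedAddCommGroup E] [NormedSpace ℝ E] [FiniteDimensional ℝ E]
  {H : Type*} [TopologicalSpace H] {I : ModelWithCorners ℝ E H}
  {M : Type*} [TopologicalSpace M] [ChartedSpace H M] [IsManifold I ∞ M]
  (g : Metric I M) {x : M}

omit [FiniteDimensional ℝ E] in
variable (I) in
/-- On a connected manifold without boundary, a function with zero differential is constant. -/
theorem eq_of_mfderiv_eq_zero [I.Boundaryless] [PreconnectedSpace M] {f : M → ℝ}
    (hf : ∀ x, MDiffAt f x) (h : ∀ x, d% f x = 0) (x y : M) : f x = f y := by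
  refine IsLocallyConstant.apply_eq_of_preconnectedSpace ?_ x y
  refine (IsLocallyConstant.iff_eventually_eq f).2 fun x ↦ ?_
  let φ := extChartAt I x
  have hopen : IsOpen φ.target := isOpen_extChartAt_target x
  obtain ⟨r, hr, hball⟩ := Metric.isOpen_iff.1 hopen _ (mem_extChartAt_target (I := I) x)
  have hd : ∀ z ∈ Metric.ball (φ x) r, HasFDerivAt (f ∘ φ.symm) (0 : E →L[ℝ] ℝ) z := by
    intro z hz
    have h1 : HasMFDerivAt I 𝓘(ℝ, ℝ) f (φ.symm z) 0 := by
      have h0 : mfderiv I 𝓘(ℝ, ℝ) f (φ.symm z) = 0 := by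
        ext v
        exact congr($(h (φ.symm z)) v)
      rw [← h0]
      exact (hf _).hasMFDerivAt
    have h2 : MDifferentiableAt 𝓘(ℝ, E) I φ.symm z :=
      (contMDiffOn_extChartAt_symm (n := ∞) x).mdifferentiableOn (by simp) z (hball hz)
        |>.mdifferentiableAt (hopen.mem_nhds (hball hz))
    have h3 := h1.comp z h2.hasMFDerivAt
    rw [ContinuousLinearMap.zero_comp] at h3
    exact h3.hasFDerivAt
  have hnear : ∀ᶠ y in 𝓝 x, φ y ∈ Metric.ball (φ x) r :=
    (continuousAt_extChartAt x).eventually (Metric.ball_mem_nhds _ hr)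
  filter_upwards [hnear, extChartAt_source_mem_nhds (I := I) x] with y hy hys
  have := Metric.isOpen_ball.is_const_of_fderiv_eq_zero (convex_ball (φ x) r).isPreconnected
    (fun z hz ↦ (hd z hz).differentiableAt.differentiableWithinAt)
    (fun z hz ↦ (hd z hz).fderiv) hy (Metric.mem_ball_self hr)
  rwa [Function.comp_apply, Function.comp_apply, φ.left_inv hys, extChartAt_to_inv] at this

variable {K : M → ℝ}
  (hK : ∀ (y : M) (a b c d : TangentSpace I y), riemann g y a b c d
    = K y * (g.inner y a c * g.inner y b d - g.inner y a d * g.inner y b c))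

include hK

variable {g} in
theorem curv_eq_of_const {A B C : Π y : M, TangentSpace I y} (hA : SmoothField A x)
    (hB : SmoothField B x) (hC : SmoothField C x) :
    curv g A B C x = K x • (g.inner x (B x) (C x) • A x - g.inner x (A x) (C x) • B x) := by
  refine eq_of_inner_eq g fun z ↦ ?_
  rw [← riemann_eq g hA hB hC, hK]
  simp only [map_smul, map_sub, smul_apply, sub_apply, smul_eq_mul]
  ring

variable {g} in
/-- The sectional curvature is smooth wherever two vector fields span a plane. -/
theorem smoothFun_of_const {U V : Π y : M, TangentSpace I y} (hU : SmoothField U x)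
    (hV : SmoothField V x)
    (h : g.inner x (U x) (U x) * g.inner x (V x) (V x)
      - g.inner x (U x) (V x) * g.inner x (V x) (U x) ≠ 0) : SmoothFun I K x := by
  have hD : SmoothFun I (fun y ↦ g.inner y (U y) (U y) * g.inner y (V y) (V y)
      - g.inner y (U y) (V y) * g.inner y (V y) (U y)) x :=
    ((hU.inner g hU).mul (hV.inner g hV)).sub ((hU.inner g hV).mul (hV.inner g hU))
  have hN : SmoothFun I (fun y ↦ g.inner y (curv g U V V y) (U y)) x :=
    (hU.curv g hV hV).inner g hU
  have hne := hD.self_of_nhds.continuousAt.eventually_ne h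
  have hinv : SmoothFun I (fun y ↦ (g.inner y (U y) (U y) * g.inner y (V y) (V y)
      - g.inner y (U y) (V y) * g.inner y (V y) (U y))⁻¹) x :=
    SmoothFun.of_contDiffAt (φ := fun t : ℝ ↦ t⁻¹) hD
      (hne.mono fun y hy ↦ contDiffAt_inv ℝ hy)
  refine (hN.mul hinv).congr ?_
  filter_upwards [hne, hU.eventually, hV.eventually] with y hy hU hV
  rw [← riemann_eq g hU hV hV, hK]
  field_simp

variable {g} in
/-- For curvature of the form `K (g_{ac} g_{bd} - g_{ad} g_{bc})`, the second Bianchi identity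
reduces to a relation for the differential of `K`. -/
theorem dir_relation_of_const (hKs : SmoothFun I K x) {U V Z W : Π y : M, TangentSpace I y}
    (hU : SmoothField U x) (hV : SmoothField V x) (hZ : SmoothField Z x) (hW : SmoothField W x) :
    d% K x (U x) • (g.inner x (Z x) (W x) • V x - g.inner x (V x) (W x) • Z x)
    + d% K x (V x) • (g.inner x (U x) (W x) • Z x - g.inner x (Z x) (W x) • U x)
    + d% K x (Z x) • (g.inner x (V x) (W x) • U x - g.inner x (U x) (W x) • V x) = 0 := by
  have key : ∀ {A B C : Π y : M, TangentSpace I y}, SmoothField A x → SmoothField B x →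
      SmoothField C x →
      cov g A (curv g B C W) x - curv g B C (cov g A W) x - curv g (mlieBracket I B C) A W x
      = d% K x (A x) • (g.inner x (C x) (W x) • B x - g.inner x (B x) (W x) • C x)
        + K x • (g.inner x (C x) (W x) • cov g A B x - g.inner x (B x) (W x) • cov g A C x
          + g.inner x (cov g A C x) (W x) • B x - g.inner x (cov g A B x) (W x) • C x
          - g.inner x (A x) (W x) • (cov g B C x - cov g C B x)
          + (g.inner x (cov g B C x) (W x) - g.inner x (cov g C B x) (W x)) • A x) := by
    intro A B C hA hB hC
    have hCB := SmoothField.smul (hC.inner g hW) hB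
    have hBC := SmoothField.smul (hB.inner g hW) hC
    have h1 : ∀ᶠ y in 𝓝 x, curv g B C W y
        = (K • ((fun y ↦ g.inner y (C y) (W y)) • B - (fun y ↦ g.inner y (B y) (W y)) • C)) y := by
      filter_upwards [hB.eventually, hC.eventually, hW.eventually] with y hB hC hW
      exact curv_eq_of_const hK hB hC hW
    rw [cov_congr g (SmoothField.smul hKs (hCB.sub hBC)) h1, cov_smul_right g hKs (hCB.sub hBC),
      cov_sub_right g hCB hBC, cov_smul_right g (hC.inner g hW) hB,
      cov_smul_right g (hB.inner g hW) hC, dir_inner g hA hC hW, dir_inner g hA hB hW,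
      curv_eq_of_const hK hB hC (hA.cov g hW), curv_eq_of_const hK (hB.bracket hC) hA hW,
      ← cov_sub_cov g hB hC]
    simp only [Pi.sub_apply, Pi.smul_apply', map_sub, sub_apply]
    module
  have h := curv_bianchi₂ g hU hV hZ hW
  rw [key hU hV hZ, key hV hZ hU, key hZ hU hV] at h
  linear_combination (norm := module) h

end Schur

/-! ### Constant curvature and the action of 2-forms -/

section Final

variable {n : ℕ} {M : Type*} [TopologicalSpace M] [ChartedSpace (EuclideanSpace ℝ (Fin n)) M]
  [IsManifold (𝓡 n) ∞ M] (g : Metric (𝓡 n) M)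

theorem exists_orthonormal_tangent_basis (x : M) :
    ∃ e : Basis (Fin n) ℝ (TangentSpace (𝓡 n) x),
      ∀ i j, form g x (e i) (e j) = if i = j then 1 else 0 :=
  exists_orthonormal_basis (form g x) (fun v w ↦ g.symm x v w) (fun v hv ↦ g.pos x v hv)
    (finrank_euclideanSpace_fin (𝕜 := ℝ) (n := n))

/-- **Schur's lemma**: on a connected manifold of dimension at least `3`, a sectional curvature
which depends only on the point is constant. -/
theorem schur [ConnectedSpace M] (hn : 3 ≤ n) {K : M → ℝ}
    (hK : ∀ (y : M) (a b c d : TangentSpace (𝓡 n) y), riemann g y a b c d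
      = K y * (g.inner y a c * g.inner y b d - g.inner y a d * g.inner y b c)) (x y : M) :
    K x = K y := by
  have hs : ∀ x, SmoothFun (𝓡 n) K x := fun x ↦ by
    obtain ⟨e, he⟩ := exists_orthonormal_tangent_basis g x
    obtain ⟨U, hU, hUx⟩ := exists_smoothField (e ⟨0, by omega⟩)
    obtain ⟨V, hV, hVx⟩ := exists_smoothField (e ⟨1, by omega⟩)
    refine smoothFun_of_const hK hU hV ?_
    have he' : ∀ i j, g.inner x (e i) (e j) = if i = j then 1 else 0 := he
    rw [hUx, hVx]
    simp [he']
  refine eq_of_mfderiv_eq_zero (𝓡 n) (fun x ↦ (hs x).mdiff) (fun x ↦ ?_) x y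
  obtain ⟨e, he⟩ := exists_orthonormal_tangent_basis g x
  have he' : ∀ i j, g.inner x (e i) (e j) = if i = j then 1 else 0 := he
  have h0 : (mvfderiv (𝓡 n) K x).toLinearMap = 0 := e.ext fun i ↦ by
    have hcard : ∀ s : Finset (Fin n), s.card ≤ 2 → ∃ j, j ∉ s := fun s hs ↦ by
      by_contra! hall
      have := Finset.card_le_card (show Finset.univ ⊆ s from fun j _ ↦ hall j)
      simp at this
      omega
    obtain ⟨j, hj⟩ := hcard {i} (by simp)
    obtain ⟨k, hk⟩ := hcard {i, j} Finset.card_le_two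
    simp only [Finset.mem_insert, Finset.mem_singleton, not_or] at hj hk
    obtain ⟨U, hU, hUx⟩ := exists_smoothField (e i)
    obtain ⟨V, hV, hVx⟩ := exists_smoothField (e j)
    obtain ⟨Z, hZ, hZx⟩ := exists_smoothField (e k)
    -- with `W = Z`, the relation at `x` reads `dK(e i) • e j = dK(e j) • e i`
    have h := dir_relation_of_const hK (hs x) hU hV hZ hZ
    have h' := congr(g.inner x $h (e j))
    rw [hUx, hVx, hZx] at h'
    simpa [he', hj, hk, Ne.symm hj, Ne.symm hk.1, Ne.symm hk.2] using h'
  ext v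
  exact congr($h0 v)

/-- The Gram determinant of two linearly independent vectors does not vanish. -/
theorem gram_ne_zero {x : M} {u v : TangentSpace (𝓡 n) x} (h : LinearIndependent ℝ ![u, v]) :
    g.inner x u u * g.inner x v v - g.inner x u v ^ 2 ≠ 0 := by
  intro h0
  have hu : u ≠ 0 := by simpa using h.ne_zero 0
  -- up to the factor `g(u,u)`, the component of `v` orthogonal to `u`
  have hw : g.inner x u u • v - g.inner x u v • u ≠ 0 := by
    intro hw
    have := LinearIndependent.pair_iff.1 h (-g.inner x u v) (g.inner x u u)
      (by rw [← hw]; module)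
    exact (g.pos x u hu).ne' this.2
  have h1 := g.pos x _ hw
  simp only [map_sub, map_smul, sub_apply, smul_apply, smul_eq_mul] at h1
  rw [g.symm x v u] at h1
  have : g.inner x u u * (g.inner x u u * g.inner x v v - g.inner x u v ^ 2) = 0 := by
    rw [h0, mul_zero]
  nlinarith

theorem riemann_of_hasConstantCurvature (h : HasConstantCurvature g) : ∃ κ : ℝ,
    ∀ (x : M) (a b c d : TangentSpace (𝓡 n) x), riemann g x a b c d
      = κ * (g.inner x a c * g.inner x b d - g.inner x a d * g.inner x b c) := by
  obtain ⟨κ, hκ⟩ := h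
  refine ⟨κ, fun x ↦ (isAlgCurv_riemann g x).eq_of_sectional
    (IsAlgCurv.const (form g x) (fun v w ↦ g.symm x v w) κ) fun u v ↦ ?_⟩
  by_cases hli : LinearIndependent ℝ ![u, v]
  · have h1 := hκ x u v hli
    rw [sectionalCurvature, div_eq_iff (gram_ne_zero g hli)] at h1
    rw [h1, g.symm x v u]
    ring
  · have hR := isAlgCurv_riemann g x
    -- both sides vanish on linearly dependent pairs
    rcases eq_or_ne u 0 with rfl | hu
    · have := hR.smul_left 0 0 v 0 v
      simpa using this
    · rw [LinearIndependent.pair_iff' hu] at hli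
      push Not at hli
      obtain ⟨r, rfl⟩ := hli
      rw [hR.smul_second, hR.self_left]
      simp
      ring_nf
      simp

theorem inner_raise (x : M) (L : LinearMap.BilinForm ℝ (TangentSpace (𝓡 n) x))
    (a t : TangentSpace (𝓡 n) x) : g.inner x (raise g x L a) t = L t a :=
  inner_sharp g x _ t

/-- A curvature tensor of the form `κ (g_{ac} g_{bd} - g_{ad} g_{bc})` is annihilated by every
2-form, since `L^s_a` is skew-adjoint. -/
theorem star_eq_zero_of_hasConstantCurvature (h : HasConstantCurvature g) (x : M)
    (L : LinearMap.BilinForm ℝ (TangentSpace (𝓡 n) x)) (hL : L.IsAlt)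
    (a b c d : TangentSpace (𝓡 n) x) : star g x (riemann g x) L a b c d = 0 := by
  obtain ⟨κ, hκ⟩ := riemann_of_hasConstantCurvature g h
  have hr : ∀ v w, g.inner x v (raise g x L w) = L v w := fun v w ↦ by
    rw [g.symm, inner_raise]
  have hs : ∀ v w, L v w = -L w v := fun v w ↦ (hL.neg_eq w v).symm
  simp only [star, hκ, inner_raise, hr]
  rw [hs c a, hs d a, hs c b, hs d b]
  ring

/-- If every 2-form annihilates the curvature tensor at `x`, then the curvature is constant at
`x`. -/
theorem exists_riemann_eq_of_star_eq_zero (hn : 2 ≤ n) (x : M)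
    (h : ∀ L : LinearMap.BilinForm ℝ (TangentSpace (𝓡 n) x), L.IsAlt →
      ∀ a b c d, star g x (riemann g x) L a b c d = 0) :
    ∃ κ : ℝ, ∀ a b c d : TangentSpace (𝓡 n) x, riemann g x a b c d
      = κ * (g.inner x a c * g.inner x b d - g.inner x a d * g.inner x b c) := by
  obtain ⟨e, he⟩ := exists_orthonormal_tangent_basis g x
  refine (isAlgCurv_riemann g x).exists_const (fun v w ↦ g.symm x v w) hn he
    fun p q a b c d ↦ ?_
  -- the 2-form corresponding to the infinitesimal rotation in the plane of `p` and `q`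
  let L : LinearMap.BilinForm ℝ (TangentSpace (𝓡 n) x) :=
    LinearMap.mk₂ ℝ
      (fun t v ↦ g.inner x v q * g.inner x p t - g.inner x v p * g.inner x q t)
      (by intros; simp; ring) (by intros; simp; ring) (by intros; simp; ring)
      (by intros; simp; ring)
  have hL : L.IsAlt := fun t ↦ by
    change g.inner x t q * g.inner x p t - g.inner x t p * g.inner x q t = 0
    rw [g.symm x q t, g.symm x p t]; ring
  have hraise : ∀ v, raise g x L v = g.inner x v q • p - g.inner x v p • q := fun v ↦ by
    refine eq_of_inner_eq g fun t ↦ ?_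
    rw [inner_raise]
    simp [L]
  have := h L hL a b c d
  simp only [star, hraise] at this
  exact this

theorem hasConstantCurvature_of_star_eq_zero [ConnectedSpace M] (hn : 3 ≤ n)
    (h : ∀ (x : M) (L : LinearMap.BilinForm ℝ (TangentSpace (𝓡 n) x)), L.IsAlt →
      ∀ a b c d, star g x (riemann g x) L a b c d = 0) : HasConstantCurvature g := by
  choose K hK using fun x ↦ exists_riemann_eq_of_star_eq_zero g (by omega) x (h x)
  obtain ⟨x₀⟩ := (inferInstance : Nonempty M)
  refine ⟨K x₀, fun x u v huv ↦ ?_⟩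
  rw [sectionalCurvature, hK, schur g hn hK x₀ x, g.symm x v u, ← sq,
    mul_div_cancel_right₀ _ (gram_ne_zero g huv)]

end Final

end ConstCurv

theorem mainTheorem2 (n : ℕ) (hn : 3 ≤ n)
    (M : Type*) [TopologicalSpace M] [T2Space M] [ConnectedSpace M]
    [ChartedSpace (EuclideanSpace ℝ (Fin n)) M] [IsManifold (𝓡 n) ∞ M]
    (g : ConstCurv.Metric (𝓡 n) M) :
    ConstCurv.HasConstantCurvature g ↔
      ∀ (x : M) (L : LinearMap.BilinForm ℝ (TangentSpace (𝓡 n) x)), L.IsAlt →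
        ∀ a b c d : TangentSpace (𝓡 n) x,
          ConstCurv.star g x (ConstCurv.riemann g x) L a b c d = 0 :=
  ⟨ConstCurv.star_eq_zero_of_hasConstantCurvature g,
    ConstCurv.hasConstantCurvature_of_star_eq_zero g hn⟩
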